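/- Conventions. One mode has phase space $\mathbb{R}^2$ with coordinates $(q,p)$ and symplectic form $\Omega_1=\begin{pmatrix}0&1\\-1&0\end{pmatrix}$; one data mode and one ancilla mode have phase space $\mathbb{R}^2\oplus\mathbb{R}^2$ with form $\Omega_1\oplus\Omega_1$. A matrix $S$ is symplectic if $S\Omega S^\top=\Omega$. Put $\ell=\sqrt{2\pi}$, and let $D_\zeta=\exp(i\zeta^\top\Omega_1\hat r)$, $\zeta\in\mathbb{R}^2$, be the displacement operators of one mode. The two-mode-squeezing matrix of gain $G\ge1$ is $S_G=\begin{pmatrix}\sqrt G\,I&\sqrt{G-1}\,Z\\ \sqrt{G-1}\,Z&\sqrt G\,I\end{pmatrix}$ with $Z=\mathrm{diag}(1,-1)$. The square GKP state is $|\square\rangle=\sum_{n\in\mathbb{Z}}|n\ell\rangle_q$, and for a symplectic $2\times2$ matrix $\Lambda$, $U_\Lambda$ denotes a unitary that implements $\Lambda$, i.e. $U_\Lambda^\dagger D_\zeta U_\Lambda=D_{\Lambda^{-1}\zeta}$ for all $\zeta$. A GKP-O2O code (one data mode, one ancilla mode) consists of a symplectic encoding matrix $S_{\rm enc}$ of size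 $4\times4$; an invertible $2\times2$ matrix $M=(v_1,v_2)$ such that $M^\top\Omega_1M$ has integer entries; an ancilla lattice state $|\mathcal L\rangle$, i.e. a nonzero simultaneous $+1$ eigenstate of the stabilizers $D_{\ell v_1},D_{\ell v_2}$; and a measurable estimator $f:\mathbb{R}^2\to\mathbb{R}^2$. Under i.i.d. additive Gaussian noise $\xi\sim\mathcal N(0,\sigma^2I_4)$, the noise after decoding is $x=(x_d,x_a)=S_{\rm enc}^{-1}\xi$, the syndrome is $s=M^\top\Omega_1x_a \bmod \sqrt{2\pi}$ (entrywise, represented in $[-\sqrt{\pi/2},\sqrt{\pi/2})$), and the residual displacement on the data is $x_{\rm out}=x_d-f(s)$. If $x_{\rm out}$ has finite second moments, let $V_{\rm out}$ be its matrix of second moments and $\bar\sigma^2_{\rm GM}=\sqrt{\det V_{\rm out}}$ its geometric-mean error. For $G\ge1$ and $\Lambda$ symplectic, a code $\mathsf{TMS}(\mathcal L_\Lambda)$ of gain $G$ is a GKP-O2O code with $S_{\rm enc}=S_G$, $M=\Lambda$ and ancilla state $|\mathcal L_\Lambda\rangle=U_\Lambda|\square\rangle$ (and any estimator). Theorem.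 For single-mode data and ancilla undergoing i.i.d. additive Gaussian noise, the codes $\mathsf{TMS}(\mathcal L_\Lambda)$ are optimal among all GKP-O2O codes. Precisely: (i) For all $G\ge1$, all symplectic $\Lambda$ and all measurable $f$ there is a GKP-O2O code $\mathsf{TMS}(\mathcal L_\Lambda)$ of gain $G$ with estimator $f$. (ii) For every GKP-O2O code $\mathcal C$ there are $G\ge1$, a symplectic $\Lambda$, a code $\mathcal T=\mathsf{TMS}(\mathcal L_\Lambda)$ of gain $G$ with a suitable estimator, and a symplectic $2\times2$ matrix $P$ such that for every $\sigma>0$ the residual displacement of $\mathcal C$ has the same law as $P$ applied to the residual displacement of $\mathcal T$; in particular, if the residual displacement of $\mathcal C$ has finite second moments, then so has that of $\mathcal T$, and $\bar\sigma^2_{\rm GM}(\mathcal T)=\bar\sigma^2_{\rm GM}(\mathcal C)$. (iii) Consequently, for every $\sigma>0$, with all codes restricted to those whose residual displacement has finite second moments, the infimum of $\bar\sigma^2_{\rm GM}$ over all GKP-O2O codes equals its infimum over the codes $\mathsf{TMS}(\mathcal L_\Lambda)$ (over all $G$, $\Lambda$ and estimators), and a code $\mathsf{TMS}(\mathcal L_\Lambda)$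 that minimizes $\bar\sigma^2_{\rm GM}$ among such codes minimizes it among all GKP-O2O codes. -/

import Mathlib

open Matrix MeasureTheory ProbabilityTheory
open scoped SchwartzMap

noncomputable section

namespace GKP

/-! ### Phase space and symplectic matrices

One mode has phase space `Fin 2 → ℝ`, with coordinates `(q, p)`. The joint system of one data mode
and one ancilla mode has phase space `Fin 2 ⊕ Fin 2 → ℝ`: `Sum.inl` is the data mode, `Sum.inr` is
the ancilla mode. -/

/-- The symplectic form of one mode. -/
def Ω₁ : Matrix (Fin 2) (Fin 2) ℝ := !![0, 1; -1, 0]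

/-- The symplectic form of the two modes (data and ancilla). -/
def Ω₂ : Matrix (Fin 2 ⊕ Fin 2) (Fin 2 ⊕ Fin 2) ℝ := Matrix.fromBlocks Ω₁ 0 0 Ω₁

/-- `S` is symplectic with respect to the form `Ω`. -/
def IsSymplectic {ι : Type*} [Fintype ι] (Ω S : Matrix ι ι ℝ) : Prop := S * Ω * Sᵀ = Ω

/-- The Pauli `Z` matrix. -/
def pauliZ : Matrix (Fin 2) (Fin 2) ℝ := !![1, 0; 0, -1]

/-- The two-mode-squeezing matrix of gain `G`. -/
def twoModeSqueezing (G : ℝ) : Matrix (Fin 2 ⊕ Fin 2) (Fin 2 ⊕ Fin 2) ℝ :=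
  Matrix.fromBlocks (Real.sqrt G • (1 : Matrix (Fin 2) (Fin 2) ℝ)) (Real.sqrt (G - 1) • pauliZ)
    (Real.sqrt (G - 1) • pauliZ) (Real.sqrt G • (1 : Matrix (Fin 2) (Fin 2) ℝ))

/-- The canonical spacing `ℓ = √(2π)`. -/
def ell : ℝ := Real.sqrt (2 * Real.pi)

theorem ell_pos : 0 < ell := Real.sqrt_pos.mpr (by positivity)

theorem ell_mul_ell : ell * ell = 2 * Real.pi := Real.mul_self_sqrt (by positivity)

/-! ### Displacement operators and kets of one mode -/

/-- The phase of the displacement operator. -/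
def weylPhase (ζ : Fin 2 → ℝ) (x : ℝ) : ℂ :=
  Complex.exp (((-(ζ 1 * (x + ζ 0 / 2)) : ℝ) : ℂ) * Complex.I)

/-- The displacement operator `D_ζ = exp (i ζᵀ Ω r̂) = exp (i (ζ₀ p̂ - ζ₁ q̂))` of one mode on Schwartz
wave functions: `(D_ζ f)(x) = exp (- i ζ₁ (x + ζ₀ / 2)) f (x + ζ₀)` (see `displacement_apply`). -/
def displacement (ζ : Fin 2 → ℝ) : 𝓢(ℝ, ℂ) →L[ℂ] 𝓢(ℝ, ℂ) :=
  (SchwartzMap.smulLeftCLM ℂ (weylPhase ζ)).comp (SchwartzMap.compSubConstCLM ℂ (-ζ 0))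

theorem hasTemperateGrowth_expI :
    Function.HasTemperateGrowth (fun t : ℝ => Complex.exp ((t : ℂ) * Complex.I)) := by
  have h : ∀ n : ℕ, iteratedDeriv n (fun t : ℝ => Complex.exp ((t : ℂ) * Complex.I)) =
      fun t : ℝ => Complex.I ^ n * Complex.exp ((t : ℂ) * Complex.I) := by
    intro n
    induction n with
    | zero => simp
    | succ k ih =>
      rw [iteratedDeriv_succ, ih]
      funext t
      have h1 : HasDerivAt (fun t : ℝ => (t : ℂ) * Complex.I) Complex.I t := by
        simpa using (Complex.ofRealCLM.hasDerivAt (x := t)).mul_const Complex.I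
      have h2 := (h1.cexp).const_mul (Complex.I ^ k)
      rw [h2.deriv]
      ring
  refine ⟨(Complex.ofRealCLM.contDiff.mul contDiff_const).cexp, fun n => ⟨0, 1, fun t => ?_⟩⟩
  rw [norm_iteratedFDeriv_eq_norm_iteratedDeriv, h n]
  simp [Complex.norm_exp]

theorem hasTemperateGrowth_weylPhase (ζ : Fin 2 → ℝ) :
    Function.HasTemperateGrowth (weylPhase ζ) := by
  have h : Function.HasTemperateGrowth (fun x : ℝ => -(ζ 1 * (x + ζ 0 / 2))) := by fun_prop
  exact hasTemperateGrowth_expI.comp h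

theorem displacement_apply (ζ : Fin 2 → ℝ) (f : 𝓢(ℝ, ℂ)) (x : ℝ) :
    displacement ζ f x =
      Complex.exp (((-(ζ 1 * (x + ζ 0 / 2)) : ℝ) : ℂ) * Complex.I) * f (x + ζ 0) := by
  simp [displacement, SchwartzMap.smulLeftCLM_apply_apply (hasTemperateGrowth_weylPhase ζ),
    weylPhase]

/-- Generalized (not necessarily normalizable) kets of one mode: continuous conjugate-linear
functionals `φ ↦ ⟨φ|ψ⟩` on Schwartz space. A wave function `g` is the ket `φ ↦ ∫ conj (φ x) * g x`;
the position eigenstate `|x⟩` is the ket `φ ↦ conj (φ x)`. -/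
abbrev Ket := 𝓢(ℝ, ℂ) →L⋆[ℂ] ℂ

/-- The displacement operator on kets, `⟨φ|D_ζ ψ⟩ = ⟨D_{-ζ} φ|ψ⟩` (as `D_ζ† = D_{-ζ}`). -/
def displaceKet (ζ : Fin 2 → ℝ) (ψ : Ket) : Ket := ψ.comp (displacement (-ζ))

/-- A continuous linear automorphism `U` of Schwartz space is a Gaussian unitary `U_Λ`, i.e. it
extends to a unitary of `L²` and implements `Λ` on displacements:
`U† D_ζ U = D_{Λ⁻¹ ζ}`, in the form `U D_ζ = D_{Λ ζ} U`. -/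
structure IsGaussianUnitary (Λ : Matrix (Fin 2) (Fin 2) ℝ) (U : 𝓢(ℝ, ℂ) ≃L[ℂ] 𝓢(ℝ, ℂ)) : Prop where
  isometry : ∀ f : 𝓢(ℝ, ℂ), ∫ x, ‖U f x‖ ^ 2 = ∫ x, ‖f x‖ ^ 2
  intertwines : ∀ (ζ : Fin 2 → ℝ) (f : 𝓢(ℝ, ℂ)),
    U (displacement ζ f) = displacement (Λ *ᵥ ζ) (U f)

/-- The action of a unitary on kets, `⟨φ|U ψ⟩ = ⟨U† φ|ψ⟩` with `U† = U⁻¹`. -/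
def unitaryKet (U : 𝓢(ℝ, ℂ) ≃L[ℂ] 𝓢(ℝ, ℂ)) (ψ : Ket) : Ket :=
  ψ.comp (U.symm : 𝓢(ℝ, ℂ) →L[ℂ] 𝓢(ℝ, ℂ))

theorem comb_bound (φ : 𝓢(ℝ, ℂ)) (n : ℤ) :
    ‖φ (n * ell)‖ ≤ (1 / ((n : ℝ) ^ 2 + 1)) *
      (8 * (Finset.Iic ((2 : ℕ), (0 : ℕ))).sup
        (fun m => SchwartzMap.seminorm ℂ m.1 m.2) φ) := by
  set P := (Finset.Iic ((2 : ℕ), (0 : ℕ))).sup (fun m => SchwartzMap.seminorm ℂ m.1 m.2) φ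
  have h := SchwartzMap.one_add_le_sup_seminorm_apply (𝕜 := ℂ) (m := (2, 0)) (k := 2) (n := 0)
    le_rfl le_rfl φ (n * ell)
  have h' : (1 + ‖(n : ℝ) * ell‖) ^ 2 * ‖φ (n * ell)‖ ≤ 4 * P := by
    simp only [norm_iteratedFDeriv_zero] at h
    refine h.trans (le_of_eq ?_)
    norm_num [P]
  have hl : 1 ≤ ell := by
    unfold ell
    rw [Real.one_le_sqrt]
    nlinarith [Real.pi_gt_three]
  have h2 : (n : ℝ) ^ 2 + 1 ≤ (1 + ‖(n : ℝ) * ell‖) ^ 2 := by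
    rw [norm_mul, Real.norm_eq_abs, Real.norm_eq_abs, abs_of_pos ell_pos]
    have : |(n : ℝ)| ≤ |(n : ℝ)| * ell := le_mul_of_one_le_right (abs_nonneg _) hl
    nlinarith [sq_abs (n : ℝ), abs_nonneg (n : ℝ)]
  have hP : 0 ≤ P := apply_nonneg _ _
  rw [one_div, inv_mul_eq_div, le_div_iff₀ (by positivity)]
  calc ‖φ (n * ell)‖ * ((n : ℝ) ^ 2 + 1)
      ≤ ‖φ (n * ell)‖ * (1 + ‖(n : ℝ) * ell‖) ^ 2 := by gcongr
    _ ≤ 8 * P := by linarith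

theorem summable_comb_weight : Summable (fun n : ℤ => 1 / ((n : ℝ) ^ 2 + 1)) := by
  have h : Summable (fun n : ℤ => 1 / (n : ℝ) ^ 2) :=
    Real.summable_one_div_int_pow.mpr (by norm_num)
  refine Summable.of_norm_bounded_eventually h ?_
  rw [Filter.eventually_cofinite]
  refine (Set.finite_singleton (0 : ℤ)).subset fun n hn => ?_
  by_contra hne
  apply hn
  have hn0 : (0 : ℝ) < (n : ℝ) ^ 2 := by
    have : (n : ℝ) ≠ 0 := by exact_mod_cast hne
    positivity
  rw [Real.norm_of_nonneg (by positivity)]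
  exact one_div_le_one_div_of_le hn0 (by linarith)

theorem summable_comb (φ : 𝓢(ℝ, ℂ)) : Summable (fun n : ℤ => star (φ (n * ell))) :=
  Summable.of_norm_bounded (summable_comb_weight.mul_right _)
    fun n => (norm_star _).le.trans (comb_bound φ n)

/-- The canonical square GKP state `|□⟩ = ∑ₙ |n √(2π)⟩_q`, a sum of position eigenstates:
`⟨φ|□⟩ = ∑ₙ conj (φ (n √(2π)))`. -/
def squareGKP : Ket :=
  SchwartzMap.mkCLMtoNormedSpace (σ := starRingEnd ℂ)
    (fun φ : 𝓢(ℝ, ℂ) => ∑' n : ℤ, star (φ (n * ell)))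
    (fun f g => by
      simpa using (summable_comb f).tsum_add (summable_comb g))
    (fun a f => by
      simp [tsum_mul_left])
    ⟨Finset.Iic (2, 0), (∑' n : ℤ, 1 / ((n : ℝ) ^ 2 + 1)) * 8, by positivity, fun f => by
      refine (tsum_of_norm_bounded (summable_comb_weight.mul_right _).hasSum
        (fun n => (norm_star _).le.trans (comb_bound f n))).trans (le_of_eq ?_)
      rw [tsum_mul_right, mul_assoc]
      rfl⟩

/-! ### Lattices and lattice states of one mode -/

/-- The columns of `M` form a basis of a symplectically integral lattice of full rank. -/
structure IsIntegralLatticeBasis (M : Matrix (Fin 2) (Fin 2) ℝ) : Prop where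
  det_ne_zero : M.det ≠ 0
  integral : ∀ j k, ∃ n : ℤ, (Mᵀ * Ω₁ * M) j k = n

/-- `ψ` is a GKP lattice state for the lattice basis given by the columns `vⱼ` of `M`: a nonzero
simultaneous `+1` eigenstate of the stabilizer generators `D_{ℓ vⱼ}`. -/
structure IsLatticeState (M : Matrix (Fin 2) (Fin 2) ℝ) (ψ : Ket) : Prop where
  ne_zero : ψ ≠ 0
  stabilized : ∀ j, displaceKet (ell • fun i => M i j) ψ = ψ

/-- The syndrome `Mᵀ Ω e mod √(2π)` of a displacement error `e`, each entry being represented in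
`[-√(π/2), √(π/2))`. -/
def syndrome (M : Matrix (Fin 2) (Fin 2) ℝ) (e : Fin 2 → ℝ) : Fin 2 → ℝ :=
  fun j => toIcoMod ell_pos (-(ell / 2)) (((Mᵀ * Ω₁) *ᵥ e) j)

/-- The Weyl commutation relation. -/
theorem displacement_comm (ζ ν : Fin 2 → ℝ) (f : 𝓢(ℝ, ℂ)) :
    displacement ζ (displacement ν f) =
      Complex.exp (((-(ζ 0 * ν 1 - ζ 1 * ν 0) : ℝ) : ℂ) * Complex.I) •
        displacement ν (displacement ζ f) := by
  ext x
  simp only [displacement_apply, _root_.smul_apply, smul_eq_mul]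
  rw [add_right_comm x (ζ 0) (ν 0), ← mul_assoc, ← mul_assoc, ← mul_assoc, ← Complex.exp_add,
    ← Complex.exp_add, ← Complex.exp_add]
  congr 2
  push_cast
  ring

/-- The syndrome is what the stabilizers measure: the displaced lattice state `D_e ψ` is an
eigenstate of `D_{ℓ vⱼ}` with eigenvalue `exp (- i ℓ sⱼ)`, where `s` is the syndrome of `e`. -/
theorem stabilizer_eigenvalue {M : Matrix (Fin 2) (Fin 2) ℝ} {ψ : Ket} (h : IsLatticeState M ψ)
    (e : Fin 2 → ℝ) (j : Fin 2) :
    displaceKet (ell • fun i => M i j) (displaceKet e ψ) =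
      Complex.exp (((-(ell * syndrome M e j) : ℝ) : ℂ) * Complex.I) • displaceKet e ψ := by
  set v : Fin 2 → ℝ := ell • fun i => M i j with hv
  ext φ
  have h1 : displaceKet v (displaceKet e ψ) φ = ψ (displacement (-e) (displacement (-v) φ)) := rfl
  have h2 : ψ (displacement (-v) (displacement (-e) φ)) = ψ (displacement (-e) φ) :=
    congrArg (fun χ : Ket => χ (displacement (-e) φ)) (h.stabilized j)
  have h3 : (displaceKet e ψ) φ = ψ (displacement (-e) φ) := rfl
  rw [h1, displacement_comm, map_smulₛₗ, h2, _root_.smul_apply, h3, smul_eq_mul,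
    smul_eq_mul]
  congr 1
  rw [← Complex.exp_conj, map_mul, Complex.conj_I, Complex.conj_ofReal]
  have hs : ((Mᵀ * Ω₁) *ᵥ e) j = syndrome M e j +
      toIcoDiv ell_pos (-(ell / 2)) (((Mᵀ * Ω₁) *ᵥ e) j) • ell :=
    (toIcoMod_add_toIcoDiv_zsmul ell_pos _ _).symm
  set k := toIcoDiv ell_pos (-(ell / 2)) (((Mᵀ * Ω₁) *ᵥ e) j)
  have hω : ((Mᵀ * Ω₁) *ᵥ e) j = M 0 j * e 1 - M 1 j * e 0 := by
    simp [Matrix.mulVec, dotProduct, Matrix.mul_apply, Ω₁, Fin.sum_univ_two]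
    ring
  rw [Complex.exp_eq_exp_iff_exists_int]
  refine ⟨-k, ?_⟩
  have hr : (-e) 0 * (-v) 1 - (-e) 1 * (-v) 0 = -(ell * syndrome M e j) - k * (2 * Real.pi) := by
    have : syndrome M e j = M 0 j * e 1 - M 1 j * e 0 - k * ell := by
      rw [← hω, hs, zsmul_eq_mul]; ring
    rw [this, ← ell_mul_ell, hv]
    simp only [Pi.neg_apply, Pi.smul_apply, smul_eq_mul]
    ring
  rw [hr]
  push_cast
  ring

/-! ### GKP oscillator-to-oscillator codes with one data mode and one ancilla mode -/

/-- A GKP-O2O code for one data mode and one ancilla mode: a Gaussian encoding, given by its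
symplectic matrix; a GKP lattice state of the ancilla, with the lattice basis that defines its
stabilizer generators; and an estimator of the data noise from the syndrome. -/
structure GKPO2OCode where
  /-- the symplectic matrix of the encoding -/
  enc : Matrix (Fin 2 ⊕ Fin 2) (Fin 2 ⊕ Fin 2) ℝ
  enc_symplectic : IsSymplectic Ω₂ enc
  /-- the generator matrix of the ancilla lattice -/
  gen : Matrix (Fin 2) (Fin 2) ℝ
  gen_integral : IsIntegralLatticeBasis gen
  /-- the ancilla state -/
  ancilla : Ket
  ancilla_lattice : IsLatticeState gen ancilla
  /-- the estimator -/
  est : (Fin 2 → ℝ) → (Fin 2 → ℝ)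
  est_measurable : Measurable est

/-- The law of the random displacement of iid additive Gaussian noise of standard deviation `σ` on
the two modes: all four quadratures are independent with law `N(0, σ²)`. -/
def iidAGN (σ : ℝ) : Measure (Fin 2 ⊕ Fin 2 → ℝ) :=
  Measure.pi fun _ => gaussianReal 0 (Real.toNNReal (σ ^ 2))

namespace GKPO2OCode

/-- The residual displacement `x_out = x_d - f (s)` of the data, where `x = (x_d, x_a) = S_enc⁻¹ ξ`
is the noise after decoding and `s` is the syndrome of the ancilla noise `x_a`. -/
def residual (C : GKPO2OCode) (ξ : Fin 2 ⊕ Fin 2 → ℝ) : Fin 2 → ℝ :=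
  (fun i => (C.enc⁻¹ *ᵥ ξ) (Sum.inl i)) -
    C.est (syndrome C.gen fun i => (C.enc⁻¹ *ᵥ ξ) (Sum.inr i))

/-- The law of the residual displacement: the code turns the noise of the two modes into additive
noise with this law on the data mode. -/
def outputLaw (C : GKPO2OCode) (σ : ℝ) : Measure (Fin 2 → ℝ) := (iidAGN σ).map C.residual

/-- The residual displacement has finite second moments. -/
def HasFiniteNoise (C : GKPO2OCode) (σ : ℝ) : Prop :=
  ∀ i, Integrable (fun x : Fin 2 → ℝ => x i ^ 2) (C.outputLaw σ)

/-- The output covariance matrix `V_out`: the second moments of the residual displacement. -/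
def Vout (C : GKPO2OCode) (σ : ℝ) : Matrix (Fin 2) (Fin 2) ℝ :=
  Matrix.of fun i j => ∫ x, x i * x j ∂(C.outputLaw σ)

/-- The geometric-mean error `σ_GM² = (det V_out) ^ (1 / 2N)` with `N = 1`. -/
def gmError (C : GKPO2OCode) (σ : ℝ) : ℝ := Real.sqrt (C.Vout σ).det

/-- `C` is the two-mode-squeezing code `TMS(𝓛_Λ)` of gain `G`: the encoding is two-mode squeezing of
gain `G`, and the ancilla is the lattice state `|𝓛_Λ⟩ = U_Λ|□⟩`, whose lattice has the
generator matrix `Λ`. The estimator is free. -/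
structure IsTMS (C : GKPO2OCode) (G : ℝ) (Λ : Matrix (Fin 2) (Fin 2) ℝ) : Prop where
  one_le_gain : 1 ≤ G
  symplectic : IsSymplectic Ω₁ Λ
  enc_eq : C.enc = twoModeSqueezing G
  gen_eq : C.gen = Λ
  ancilla_eq : ∃ U : 𝓢(ℝ, ℂ) ≃L[ℂ] 𝓢(ℝ, ℂ),
    IsGaussianUnitary Λ U ∧ C.ancilla = unitaryKet U squareGKP

end GKPO2OCode

end GKP

end

noncomputable section

namespace GKP

open FourierTransform

/-! The decoded noise `S⁻¹ ξ` is a centred Gaussian, so its law depends on the encoding `S` only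
through `V = S⁻¹ S⁻ᵀ` (`map_mulVec_iidAGN_eq`). This `V` is positive definite and satisfies `V Ω₂ V
= Ω₂`, so symplectic maps `P` on the data and `Q` on the ancilla bring it to the covariance of a
two-mode squeezer (`exists_normalForm`). Hence `S⁻¹ ξ` has the law of `(P ⊕ Q) S_G⁻¹ ξ`.

The local factors do no harm. `P` passes through to the residual displacement, and as `det P = 1` it
leaves `det V_out` unchanged. `Q` is absorbed into the ancilla lattice, because syndromes are
symplectically invariant. Finally an integral lattice is a sublattice of a self-dual one `Λ`, whose
syndrome determines that of the sublattice; passing to `Λ` costs nothing, since the estimator can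
discard information (`decode_local_symplectic`).

The ancilla state does not enter the residual; it only has to exist. Shears and the Fourier
transform give a Gaussian unitary for every `Λ` of determinant one (`exists_isGaussianUnitary`), and
it carries the square state to a lattice state of `Λ`. -/

theorem isSymplectic_Ω₁_iff (A : Matrix (Fin 2) (Fin 2) ℝ) : IsSymplectic Ω₁ A ↔ A.det = 1 := by
  rw [IsSymplectic, Matrix.det_fin_two, ← Matrix.ext_iff]
  simp only [Fin.forall_fin_two, Matrix.mul_apply, Fin.sum_univ_two, Ω₁, Matrix.transpose_apply,
    Matrix.of_apply, Matrix.cons_val', Matrix.cons_val_zero, Matrix.cons_val_one,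
    Matrix.cons_val_fin_one]
  constructor
  · rintro ⟨⟨-, h⟩, -⟩
    linarith
  · intro h
    refine ⟨⟨by ring, by linarith⟩, by linarith, by ring⟩

/-! ### Gaussian unitaries -/

namespace IsGaussianUnitary

variable {Λ Λ' : Matrix (Fin 2) (Fin 2) ℝ} {U U' : 𝓢(ℝ, ℂ) ≃L[ℂ] 𝓢(ℝ, ℂ)}

theorem mul (h : IsGaussianUnitary Λ U) (h' : IsGaussianUnitary Λ' U') :
    IsGaussianUnitary (Λ * Λ') (U'.trans U) where
  isometry f := by
    rw [ContinuousLinearEquiv.trans_apply, h.isometry, h'.isometry]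
  intertwines ζ f := by
    rw [ContinuousLinearEquiv.trans_apply, h'.intertwines, h.intertwines, Matrix.mulVec_mulVec]
    rfl

theorem symm (h : IsGaussianUnitary Λ U) (hΛ : Λ * Λ' = 1) :
    IsGaussianUnitary Λ' U.symm where
  isometry f := by
    rw [← h.isometry, U.apply_symm_apply]
  intertwines ζ f := by
    apply U.injective
    rw [h.intertwines, U.apply_symm_apply, Matrix.mulVec_mulVec, hΛ, Matrix.one_mulVec,
      U.apply_symm_apply]

end IsGaussianUnitary

/-- The quadratic phase `exp (i t x² / 2)`. -/
def chirp (t x : ℝ) : ℂ := Complex.exp (((t / 2 * (x * x) : ℝ) : ℂ) * Complex.I)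

theorem hasTemperateGrowth_chirp (t : ℝ) : Function.HasTemperateGrowth (chirp t) := by
  have h : Function.HasTemperateGrowth (fun x : ℝ => t / 2 * (x * x)) := by fun_prop
  exact hasTemperateGrowth_expI.comp h

theorem chirp_mul_chirp_neg (t x : ℝ) : chirp t x * chirp (-t) x = 1 := by
  rw [chirp, chirp, ← Complex.exp_add, ← Complex.exp_zero]
  congr 1
  push_cast
  ring

/-- Multiplication by a quadratic phase, as an automorphism of Schwartz space. -/
def chirpEquiv (t : ℝ) : 𝓢(ℝ, ℂ) ≃L[ℂ] 𝓢(ℝ, ℂ) :=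
  ContinuousLinearEquiv.equivOfInverse (SchwartzMap.smulLeftCLM ℂ (chirp t))
    (SchwartzMap.smulLeftCLM ℂ (chirp (-t)))
    (fun f => by
      ext x
      rw [SchwartzMap.smulLeftCLM_apply_apply (hasTemperateGrowth_chirp _),
        SchwartzMap.smulLeftCLM_apply_apply (hasTemperateGrowth_chirp _), smul_smul, mul_comm,
        chirp_mul_chirp_neg, one_smul])
    (fun f => by
      ext x
      rw [SchwartzMap.smulLeftCLM_apply_apply (hasTemperateGrowth_chirp _),
        SchwartzMap.smulLeftCLM_apply_apply (hasTemperateGrowth_chirp _), smul_smul,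
        chirp_mul_chirp_neg, one_smul])

theorem chirpEquiv_apply (t : ℝ) (f : 𝓢(ℝ, ℂ)) (x : ℝ) :
    chirpEquiv t f x = chirp t x * f x :=
  SchwartzMap.smulLeftCLM_apply_apply (hasTemperateGrowth_chirp _) f x

/-- The shear comes from `t/2 * ((x + ζ₀)² - x²) = t * ζ₀ * (x + ζ₀/2)`: commuting a chirp past a
translation by `ζ₀` adds `t * ζ₀` to the momentum component. -/
theorem isGaussianUnitary_chirpEquiv (t : ℝ) :
    IsGaussianUnitary !![1, 0; t, 1] (chirpEquiv t) where
  isometry f := by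
    simp_rw [chirpEquiv_apply, norm_mul, chirp, Complex.norm_exp_ofReal_mul_I, one_mul]
  intertwines ζ f := by
    ext x
    have h0 : (!![1, 0; t, 1] *ᵥ ζ) 0 = ζ 0 := by simp [Matrix.mulVec, dotProduct]
    have h1 : (!![1, 0; t, 1] *ᵥ ζ) 1 = t * ζ 0 + ζ 1 := by simp [Matrix.mulVec, dotProduct]
    rw [displacement_apply, chirpEquiv_apply, chirpEquiv_apply, displacement_apply, h0, h1,
      ← mul_assoc, ← mul_assoc, chirp, chirp, ← Complex.exp_add, ← Complex.exp_add]
    congr 2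
    push_cast
    ring

/-- The Fourier transform exchanges translations and modulations. The factors `2π` come from the
kernel `exp (-2πi k x)`. -/
theorem isGaussianUnitary_fourier :
    IsGaussianUnitary !![0, (2 * Real.pi)⁻¹; -(2 * Real.pi), 0]
      (fourierCLE ℂ 𝓢(ℝ, ℂ)) where
  isometry f := SchwartzMap.integral_norm_sq_fourier f
  intertwines ζ f := by
    ext k
    have hpi : (Real.pi : ℂ) ≠ 0 := by exact_mod_cast Real.pi_ne_zero
    have h0 : (!![0, (2 * Real.pi)⁻¹; -(2 * Real.pi), 0] *ᵥ ζ) 0 = (2 * Real.pi)⁻¹ * ζ 1 := by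
      simp [Matrix.mulVec, dotProduct]
    have h1 : (!![0, (2 * Real.pi)⁻¹; -(2 * Real.pi), 0] *ᵥ ζ) 1 = -(2 * Real.pi) * ζ 0 := by
      simp [Matrix.mulVec, dotProduct]
    rw [displacement_apply, fourierCLE_apply, fourierCLE_apply, SchwartzMap.fourier_coe,
      SchwartzMap.fourier_coe, Real.fourier_real_eq_integral_exp_smul,
      Real.fourier_real_eq_integral_exp_smul, ← integral_const_mul, h0, h1]
    conv_rhs => rw [← integral_add_right_eq_self _ (ζ 0)]
    refine integral_congr_ae (Filter.Eventually.of_forall fun x => ?_)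
    simp only [displacement_apply, smul_eq_mul]
    rw [← mul_assoc, ← mul_assoc, ← Complex.exp_add, ← Complex.exp_add]
    congr 2
    push_cast
    field_simp
    ring

theorem exists_isGaussianUnitary_upper (u : ℝ) :
    ∃ U, IsGaussianUnitary !![1, u; 0, 1] U := by
  have hpi := Real.pi_ne_zero
  have hinv : !![0, (2 * Real.pi)⁻¹; -(2 * Real.pi), 0] *
      !![0, -(2 * Real.pi)⁻¹; 2 * Real.pi, 0] = 1 := by
    rw [Matrix.mul_fin_two, Matrix.one_fin_two]
    simp only [zero_mul, mul_zero, zero_add, add_zero, neg_mul_neg]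
    rw [inv_mul_cancel₀ (by positivity), mul_inv_cancel₀ (by positivity)]
  -- Conjugating a lower shear by the Fourier matrix gives an upper one; with parameter `t` the
  -- corner entry becomes `-t / (2π)²`.
  have h := (isGaussianUnitary_fourier.symm hinv).mul
    ((isGaussianUnitary_chirpEquiv (-(2 * Real.pi) ^ 2 * u)).mul isGaussianUnitary_fourier)
  suffices heq : !![1, u; 0, 1] = _ from heq ▸ ⟨_, h⟩
  rw [Matrix.mul_fin_two, Matrix.mul_fin_two]
  ext i j
  fin_cases i <;> fin_cases j <;> simp <;> field_simp

/-- With `c` the lower left entry, the matrix is a product of shears: upper `(a - 1)/c`, lower `c`,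
upper `(d - 1)/c`. The upper right entry comes out correctly because the determinant is one. -/
theorem exists_isGaussianUnitary_of_ne_zero {Λ : Matrix (Fin 2) (Fin 2) ℝ} (hΛ : Λ.det = 1)
    (hc : Λ 1 0 ≠ 0) : ∃ U, IsGaussianUnitary Λ U := by
  obtain ⟨U, hU⟩ := exists_isGaussianUnitary_upper ((Λ 0 0 - 1) / Λ 1 0)
  obtain ⟨V, hV⟩ := exists_isGaussianUnitary_upper ((Λ 1 1 - 1) / Λ 1 0)
  suffices heq : Λ = _ from heq ▸ ⟨_, hU.mul ((isGaussianUnitary_chirpEquiv (Λ 1 0)).mul hV)⟩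
  rw [Matrix.det_fin_two] at hΛ
  rw [Matrix.mul_fin_two, Matrix.mul_fin_two]
  ext i j
  fin_cases i <;> fin_cases j <;> simp <;> field_simp
  · ring
  · linarith
  · ring

/-- Every symplectic matrix of one mode is implemented by a Gaussian unitary. -/
theorem exists_isGaussianUnitary {Λ : Matrix (Fin 2) (Fin 2) ℝ} (hΛ : Λ.det = 1) :
    ∃ U, IsGaussianUnitary Λ U := by
  by_cases hc : Λ 1 0 = 0
  · have ha : Λ 0 0 ≠ 0 := by
      rintro ha
      simp [Matrix.det_fin_two, ha, hc] at hΛ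
    -- A lower shear moves the nonzero upper left entry into the vanishing corner, and is undone
    -- afterwards.
    obtain ⟨U, hU⟩ := exists_isGaussianUnitary_of_ne_zero (Λ := !![1, 0; 1, 1] * Λ)
      (by rw [Matrix.det_mul, hΛ]; simp) (by simpa [Matrix.mul_apply, hc] using ha)
    have hinv : !![1, 0; 1, 1] * !![1, 0; -1, 1] = (1 : Matrix (Fin 2) (Fin 2) ℝ) := by
      rw [Matrix.mul_fin_two, Matrix.one_fin_two]
      simp
    have h := ((isGaussianUnitary_chirpEquiv 1).symm hinv).mul hU
    rw [← Matrix.mul_assoc, mul_eq_one_comm.mp hinv, Matrix.one_mul] at h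
    exact ⟨_, h⟩
  · exact exists_isGaussianUnitary_of_ne_zero hΛ hc

/-! ### Lattice states obtained from the square GKP state -/

theorem squareGKP_apply (φ : 𝓢(ℝ, ℂ)) : squareGKP φ = ∑' n : ℤ, star (φ (n * ell)) := rfl

theorem squareGKP_ne_zero : squareGKP ≠ 0 := by
  -- The bump vanishes at distance at least `1` from `0`, and `ell ≥ 1`, so only the tooth `n = 0`
  -- contributes.
  let b : ContDiffBump (0 : ℝ) := ⟨1 / 2, 1, by norm_num, by norm_num⟩
  have hb : ContDiff ℝ (⊤ : ℕ∞) (fun x : ℝ => (b x : ℂ)) :=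
    Complex.ofRealCLM.contDiff.comp b.contDiff
  have hs : HasCompactSupport (fun x : ℝ => (b x : ℂ)) :=
    b.hasCompactSupport.comp_left (g := fun x : ℝ => (x : ℂ)) Complex.ofReal_zero
  intro h
  have h0 : squareGKP (hs.toSchwartzMap hb) = 0 := by rw [h]; rfl
  rw [squareGKP_apply, tsum_eq_single 0] at h0
  · have h1 : b 0 = 1 := b.one_of_mem_closedBall (Metric.mem_closedBall_self b.rIn_pos.le)
    have h2 : (hs.toSchwartzMap hb) (((0 : ℤ) : ℝ) * ell) = (b 0 : ℂ) := by
      simp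
    rw [h2, h1] at h0
    simp at h0
  · intro n hn
    have hl : 1 ≤ ell := by
      unfold ell
      rw [Real.one_le_sqrt]
      nlinarith [Real.pi_gt_three]
    have hn1 : (1 : ℝ) ≤ |(n : ℝ)| := by exact_mod_cast Int.one_le_abs hn
    have h1 : b (n * ell) = 0 := by
      apply b.zero_of_le_dist
      rw [Real.dist_eq, sub_zero, abs_mul, abs_of_pos ell_pos]
      exact one_le_mul_of_one_le_of_one_le hn1 hl
    simp [h1]

/-- The position shift by `ell` permutes the teeth; the momentum shift has trivial phase on them
because `ell² = 2π`. -/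
theorem squareGKP_displacement (φ : 𝓢(ℝ, ℂ)) (j : Fin 2) :
    squareGKP (displacement (-(ell • Pi.single j 1)) φ) = squareGKP φ := by
  rw [squareGKP_apply, squareGKP_apply]
  fin_cases j
  · rw [← (Equiv.subRight (1 : ℤ)).tsum_eq (fun n : ℤ => star (φ (n * ell)))]
    refine tsum_congr fun n => ?_
    rw [displacement_apply]
    congr 1
    simp
    congr 1
    ring
  · refine tsum_congr fun n => ?_
    rw [displacement_apply]
    congr 1
    simp only [Fin.mk_one, Pi.neg_apply, Pi.smul_apply, Pi.single_eq_same, smul_eq_mul, mul_one,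
      ne_eq, zero_ne_one, not_false_eq_true, Pi.single_eq_of_ne, mul_zero, neg_zero, zero_div,
      add_zero]
    have : Complex.exp (((-(-ell * (n * ell)) : ℝ) : ℂ) * Complex.I) = 1 := by
      rw [Complex.exp_eq_one_iff]
      refine ⟨n, ?_⟩
      have h : -(-ell * (n * ell)) = n * (2 * Real.pi) := by rw [← ell_mul_ell]; ring
      rw [h]
      push_cast
      ring
    rw [this, one_mul]

theorem isLatticeState_unitaryKet {Λ : Matrix (Fin 2) (Fin 2) ℝ} (hΛ : Λ.det = 1)
    {U : 𝓢(ℝ, ℂ) ≃L[ℂ] 𝓢(ℝ, ℂ)} (hU : IsGaussianUnitary Λ U) :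
    IsLatticeState Λ (unitaryKet U squareGKP) where
  ne_zero h := by
    refine squareGKP_ne_zero (ContinuousLinearMap.ext fun φ => ?_)
    have := congrArg (fun ψ : Ket => ψ (U φ)) h
    simpa [unitaryKet] using this
  stabilized j := by
    have hinv : Λ⁻¹ * Λ = 1 := Matrix.nonsing_inv_mul _ (by rw [hΛ]; exact isUnit_one)
    have hs := hU.symm (mul_eq_one_comm.mp hinv)
    ext φ
    change squareGKP (U.symm (displacement (-(ell • fun i => Λ i j)) φ)) = squareGKP (U.symm φ)
    have hcol : (fun i => Λ i j) = Λ *ᵥ Pi.single j 1 := by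
      ext i
      simp
    rw [hs.intertwines, hcol, Matrix.mulVec_neg, Matrix.mulVec_smul, Matrix.mulVec_mulVec, hinv,
      Matrix.one_mulVec, squareGKP_displacement]

theorem isIntegralLatticeBasis_of_det_eq_one {Λ : Matrix (Fin 2) (Fin 2) ℝ} (hΛ : Λ.det = 1) :
    IsIntegralLatticeBasis Λ where
  det_ne_zero := by rw [hΛ]; exact one_ne_zero
  integral j k := by
    have h := (isSymplectic_Ω₁_iff Λᵀ).mpr (by rw [Matrix.det_transpose, hΛ])
    rw [IsSymplectic, Matrix.transpose_transpose] at h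
    rw [h]
    fin_cases j <;> fin_cases k
    · exact ⟨0, by simp [Ω₁]⟩
    · exact ⟨1, by simp [Ω₁]⟩
    · exact ⟨-1, by simp [Ω₁]⟩
    · exact ⟨0, by simp [Ω₁]⟩

theorem pauliZ_transpose : pauliZᵀ = pauliZ := by
  ext i j
  fin_cases i <;> fin_cases j <;> rfl

theorem twoModeSqueezing_symplectic {G : ℝ} (hG : 1 ≤ G) :
    IsSymplectic Ω₂ (twoModeSqueezing G) := by
  have h1 : Real.sqrt G * Real.sqrt G = G := Real.mul_self_sqrt (by linarith)
  have h2 : Real.sqrt (G - 1) * Real.sqrt (G - 1) = G - 1 := Real.mul_self_sqrt (by linarith)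
  rw [IsSymplectic, Ω₂, twoModeSqueezing, Matrix.fromBlocks_transpose,
    Matrix.fromBlocks_multiply, Matrix.fromBlocks_multiply]
  congr 1 <;> ext i j <;> fin_cases i <;> fin_cases j <;>
    simp [Matrix.transpose_smul, pauliZ_transpose] <;> simp [Ω₁, pauliZ] <;> linarith

/-- The two-mode-squeezing code of given gain, ancilla lattice and estimator. -/
theorem exists_isTMS {G : ℝ} {Λ : Matrix (Fin 2) (Fin 2) ℝ} {f : (Fin 2 → ℝ) → (Fin 2 → ℝ)}
    (hG : 1 ≤ G) (hΛ : Λ.det = 1) (hf : Measurable f) :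
    ∃ T : GKPO2OCode, T.IsTMS G Λ ∧ T.est = f := by
  obtain ⟨U, hU⟩ := exists_isGaussianUnitary hΛ
  exact ⟨{  enc := twoModeSqueezing G
            enc_symplectic := twoModeSqueezing_symplectic hG
            gen := Λ
            gen_integral := isIntegralLatticeBasis_of_det_eq_one hΛ
            ancilla := unitaryKet U squareGKP
            ancilla_lattice := isLatticeState_unitaryKet hΛ hU
            est := f
            est_measurable := hf },
    ⟨hG, (isSymplectic_Ω₁_iff Λ).mpr hΛ, rfl, rfl, U, hU, rfl⟩, rfl⟩

/-! ### Linear images of iid Gaussian noise -/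

instance isProbabilityMeasure_iidAGN (σ : ℝ) : IsProbabilityMeasure (iidAGN σ) := by
  unfold iidAGN
  infer_instance

theorem integral_exp_dotProduct_iidAGN (σ : ℝ) (c : Fin 2 ⊕ Fin 2 → ℝ) :
    ∫ x, Complex.exp (((c ⬝ᵥ x : ℝ) : ℂ) * Complex.I) ∂(iidAGN σ) =
      Complex.exp (-((Real.toNNReal (σ ^ 2) * (c ⬝ᵥ c) / 2 : ℝ) : ℂ)) := by
  have h : ∀ x : Fin 2 ⊕ Fin 2 → ℝ, Complex.exp (((c ⬝ᵥ x : ℝ) : ℂ) * Complex.I) =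
      ∏ i, Complex.exp ((c i : ℂ) * (x i : ℂ) * Complex.I) := by
    intro x
    rw [← Complex.exp_sum, dotProduct, Complex.ofReal_sum, Finset.sum_mul]
    simp
  simp_rw [h, iidAGN]
  rw [integral_fintype_prod_eq_prod
    (fun i (y : ℝ) => Complex.exp ((c i : ℂ) * (y : ℂ) * Complex.I))]
  simp_rw [← charFun_apply_real, charFun_gaussianReal]
  rw [← Complex.exp_sum, dotProduct]
  congr 1
  push_cast
  rw [Finset.mul_sum, Finset.sum_div, ← Finset.sum_neg_distrib]
  refine Finset.sum_congr rfl fun i _ => ?_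
  ring

theorem charFunDual_map_mulVec_iidAGN (σ : ℝ) (A : Matrix (Fin 2 ⊕ Fin 2) (Fin 2 ⊕ Fin 2) ℝ)
    (L : StrongDual ℝ (Fin 2 ⊕ Fin 2 → ℝ)) (t : Fin 2 ⊕ Fin 2 → ℝ) (hL : ∀ x, L x = t ⬝ᵥ x) :
    charFunDual ((iidAGN σ).map (fun x => A *ᵥ x)) L =
      Complex.exp (-((Real.toNNReal (σ ^ 2) * (t ⬝ᵥ ((A * Aᵀ) *ᵥ t)) / 2 : ℝ) : ℂ)) := by
  rw [charFunDual_apply, integral_map (by fun_prop) (by fun_prop)]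
  simp_rw [hL, Matrix.dotProduct_mulVec t A]
  rw [integral_exp_dotProduct_iidAGN]
  rw [← Matrix.mulVec_mulVec, Matrix.dotProduct_mulVec t A, Matrix.mulVec_transpose]

/-- The law of a linear image of iid Gaussian noise is determined by its covariance matrix. -/
theorem map_mulVec_iidAGN_eq (σ : ℝ) {A B : Matrix (Fin 2 ⊕ Fin 2) (Fin 2 ⊕ Fin 2) ℝ}
    (h : A * Aᵀ = B * Bᵀ) :
    (iidAGN σ).map (fun x => A *ᵥ x) = (iidAGN σ).map (fun x => B *ᵥ x) := by
  have hA : IsProbabilityMeasure ((iidAGN σ).map (fun x => A *ᵥ x)) :=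
    Measure.isProbabilityMeasure_map (by fun_prop)
  have hB : IsProbabilityMeasure ((iidAGN σ).map (fun x => B *ᵥ x)) :=
    Measure.isProbabilityMeasure_map (by fun_prop)
  refine Measure.ext_of_charFunDual (funext fun L => ?_)
  have hL : ∀ x, L x = (fun i => L (Pi.single i 1)) ⬝ᵥ x := by
    intro x
    conv_lhs => rw [← Finset.univ_sum_single x, map_sum]
    refine Finset.sum_congr rfl fun i _ => ?_
    have : (Pi.single i (x i) : Fin 2 ⊕ Fin 2 → ℝ) = x i • Pi.single i 1 := by
      rw [← Pi.single_smul, smul_eq_mul, mul_one]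
    rw [this, map_smul, smul_eq_mul, mul_comm]
  rw [charFunDual_map_mulVec_iidAGN σ A L _ hL, charFunDual_map_mulVec_iidAGN σ B L _ hL, h]

/-! ### Standard form of the covariance matrix of a pure two-mode Gaussian state -/

/-- A linear map of the plane scales the area form by its determinant. This turns the diagonal block
equations for a covariance matrix into equations between determinants. -/
theorem mul_Ω₁_mul_transpose (A : Matrix (Fin 2) (Fin 2) ℝ) : A * Ω₁ * Aᵀ = A.det • Ω₁ := by
  ext i j
  fin_cases i <;> fin_cases j <;>
    simp [Matrix.mul_apply, Fin.sum_univ_two, Ω₁, Matrix.det_fin_two] <;> ring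

theorem transpose_mul_Ω₁_mul (A : Matrix (Fin 2) (Fin 2) ℝ) : Aᵀ * Ω₁ * A = A.det • Ω₁ := by
  simpa using mul_Ω₁_mul_transpose Aᵀ

theorem Ω₁_mul_Ω₁ : Ω₁ * Ω₁ = -1 := by
  ext i j
  fin_cases i <;> fin_cases j <;> simp [Ω₁]

theorem Ω₂_mul_Ω₂ : Ω₂ * Ω₂ = -1 := by
  rw [Ω₂, Matrix.fromBlocks_multiply, ← Matrix.fromBlocks_one, Matrix.fromBlocks_neg]
  simp [Ω₁_mul_Ω₁]

theorem pauliZ_mul_pauliZ : pauliZ * pauliZ = 1 := by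
  ext i j
  fin_cases i <;> fin_cases j <;> simp [pauliZ]

theorem IsSymplectic.isUnit_det {S : Matrix (Fin 2 ⊕ Fin 2) (Fin 2 ⊕ Fin 2) ℝ}
    (hS : IsSymplectic Ω₂ S) : IsUnit S.det := by
  have h : S * (-(Ω₂ * Sᵀ * Ω₂)) = 1 := by
    rw [Matrix.mul_neg, ← Matrix.mul_assoc, ← Matrix.mul_assoc, show S * Ω₂ * Sᵀ = Ω₂ from hS,
      Ω₂_mul_Ω₂, neg_neg]
  exact Matrix.isUnit_det_of_right_inverse h

/-- Both `S⁻¹` and its transpose preserve the form; the latter follows by inverting `S Ω₂ Sᵀ = Ω₂`,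
as `Ω₂⁻¹ = -Ω₂`. -/
theorem covariance_symplectic {S : Matrix (Fin 2 ⊕ Fin 2) (Fin 2 ⊕ Fin 2) ℝ}
    (hS : IsSymplectic Ω₂ S) :
    (S⁻¹ * S⁻¹ᵀ) * Ω₂ * (S⁻¹ * S⁻¹ᵀ) = Ω₂ := by
  have hu := hS.isUnit_det
  have hut : IsUnit Sᵀ.det := by rwa [Matrix.det_transpose]
  have h1 : S⁻¹ * S = 1 := Matrix.nonsing_inv_mul S hu
  have h2 : Sᵀ * Sᵀ⁻¹ = 1 := Matrix.mul_nonsing_inv Sᵀ hut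
  have h3 : S⁻¹ * Ω₂ * Sᵀ⁻¹ = Ω₂ := by
    have : S⁻¹ * (S * Ω₂ * Sᵀ) * Sᵀ⁻¹ = S⁻¹ * S * Ω₂ * (Sᵀ * Sᵀ⁻¹) := by
      simp only [Matrix.mul_assoc]
    rw [show S * Ω₂ * Sᵀ = Ω₂ from hS, h1, h2, Matrix.one_mul, Matrix.mul_one] at this
    exact this
  have h4 : Sᵀ⁻¹ * Ω₂ * S⁻¹ = Ω₂ := by
    have hinv : Ω₂⁻¹ = -Ω₂ :=
      Matrix.inv_eq_right_inv (by rw [Matrix.mul_neg, Ω₂_mul_Ω₂, neg_neg])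
    have := congrArg (·⁻¹) (show S * Ω₂ * Sᵀ = Ω₂ from hS)
    simp only [Matrix.mul_inv_rev, hinv, Matrix.neg_mul, Matrix.mul_neg, neg_inj] at this
    rwa [← Matrix.mul_assoc] at this
  rw [Matrix.transpose_nonsing_inv]
  calc S⁻¹ * Sᵀ⁻¹ * Ω₂ * (S⁻¹ * Sᵀ⁻¹) = S⁻¹ * (Sᵀ⁻¹ * Ω₂ * S⁻¹) * Sᵀ⁻¹ := by
        simp only [Matrix.mul_assoc]
    _ = Ω₂ := by rw [h4, h3]

theorem exists_cholesky {A : Matrix (Fin 2) (Fin 2) ℝ} (hA : A.PosDef) :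
    ∃ P : Matrix (Fin 2) (Fin 2) ℝ, P.det = 1 ∧ A = Real.sqrt A.det • (P * Pᵀ) := by
  have ha : 0 < Real.sqrt A.det := Real.sqrt_pos.mpr hA.det_pos
  have haa : Real.sqrt A.det * Real.sqrt A.det = A.det := Real.mul_self_sqrt hA.det_pos.le
  have h00 : 0 < A 0 0 := hA.diag_pos
  have hsymm : A 1 0 = A 0 1 := hA.isHermitian.apply 0 1
  rw [Matrix.det_fin_two, hsymm] at haa
  rw [Matrix.det_fin_two, hsymm] at ha ⊢
  set a := Real.sqrt (A 0 0 * A 1 1 - A 0 1 * A 0 1)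
  have hr : 0 < Real.sqrt (A 0 0 / a) := Real.sqrt_pos.mpr (by positivity)
  have hrr : Real.sqrt (A 0 0 / a) * Real.sqrt (A 0 0 / a) = A 0 0 / a :=
    Real.mul_self_sqrt (by positivity)
  set r := Real.sqrt (A 0 0 / a)
  have har : a * (r * r) = A 0 0 := by rw [hrr]; field_simp
  -- The lower triangular Cholesky factor of `A / a`, a matrix of determinant one.
  refine ⟨!![r, 0; A 0 1 / (a * r), 1 / r], ?_, ?_⟩
  · simp [Matrix.det_fin_two, hr.ne']
  · ext i j
    fin_cases i <;> fin_cases j <;> simp [Matrix.vecMul, dotProduct]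
    · exact har.symm
    · field_simp
    · rw [hsymm]; field_simp
    · field_simp
      rw [pow_two r, pow_two a]
      nlinarith

/-- Anticommuting with the complex structure `Ω₁` means being conjugate-linear, that is, symmetric
and traceless. In particular the determinant is nonpositive. -/
theorem entries_of_anticommute_Ω₁ {C : Matrix (Fin 2) (Fin 2) ℝ} (hC : Ω₁ * C + C * Ω₁ = 0) :
    C 1 0 = C 0 1 ∧ C 1 1 = -C 0 0 := by
  have h0 := congrFun (congrFun hC 0) 0
  have h1 := congrFun (congrFun hC 0) 1
  simp only [Ω₁, Matrix.add_apply, Matrix.mul_apply, Fin.sum_univ_two] at h0 h1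
  simp at h0 h1
  exact ⟨by linarith, by linarith⟩

/-- A matrix that anticommutes with `Ω₁` is a multiple of a reflection. -/
theorem exists_rotation {C : Matrix (Fin 2) (Fin 2) ℝ} (hC : Ω₁ * C + C * Ω₁ = 0) {c : ℝ}
    (hc : C.det = -(c * c)) :
    ∃ R : Matrix (Fin 2) (Fin 2) ℝ, R.det = 1 ∧ R * Rᵀ = 1 ∧ C = (-c) • (pauliZ * Rᵀ) := by
  obtain ⟨h10, h11⟩ := entries_of_anticommute_Ω₁ hC
  rw [Matrix.det_fin_two, h10, h11] at hc
  by_cases hc0 : c = 0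
  · subst hc0
    have h00 : C 0 0 = 0 := by nlinarith [sq_nonneg (C 0 0), sq_nonneg (C 0 1)]
    have h01 : C 0 1 = 0 := by nlinarith [sq_nonneg (C 0 0), sq_nonneg (C 0 1)]
    refine ⟨1, by simp, by simp, ?_⟩
    ext i j
    fin_cases i <;> fin_cases j <;> simp [h00, h01, h10, h11]
  -- Solving `C = -c Z Rᵀ` with `Z² = 1` forces `Rᵀ = -Z C / c`.
  · refine ⟨!![-C 0 0 / c, C 0 1 / c; -C 0 1 / c, -C 0 0 / c], ?_, ?_, ?_⟩
    · rw [Matrix.det_fin_two]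
      simp
      field_simp
      linarith
    · ext i j
      fin_cases i <;> fin_cases j <;> simp [Matrix.mul_apply, Fin.sum_univ_two] <;> field_simp <;>
        linarith
    · ext i j
      fin_cases i <;> fin_cases j <;>
        simp [Matrix.vecMul, dotProduct, pauliZ, h10, h11] <;> field_simp

/-- Local symplectic transformations bring the blocks of a pure two-mode covariance matrix to the
two-mode-squeezed form. -/
theorem exists_block_normalForm {A B C : Matrix (Fin 2) (Fin 2) ℝ} (hA : A.PosDef) (hB : B.PosDef)
    (h : Matrix.fromBlocks A C Cᵀ B * Ω₂ * Matrix.fromBlocks A C Cᵀ B = Ω₂) :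
    ∃ (P Q : Matrix (Fin 2) (Fin 2) ℝ) (G : ℝ), P.det = 1 ∧ Q.det = 1 ∧ 1 ≤ G ∧
      A = (2 * G - 1) • (P * Pᵀ) ∧ B = (2 * G - 1) • (Q * Qᵀ) ∧
      C = (-(2 * (Real.sqrt G * Real.sqrt (G - 1)))) • (P * pauliZ * Qᵀ) := by
  have hAt : Aᵀ = A := hA.isHermitian
  have hBt : Bᵀ = B := hB.isHermitian
  rw [Ω₂, Matrix.fromBlocks_multiply, Matrix.fromBlocks_multiply, Matrix.fromBlocks_inj] at h
  simp only [Matrix.mul_zero, add_zero, zero_add] at h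
  obtain ⟨hAA, hAC, -, hBB⟩ := h
  have hAC1 : A.det + C.det = 1 := by
    have h1 := mul_Ω₁_mul_transpose A
    rw [hAt] at h1
    rw [h1, mul_Ω₁_mul_transpose, ← add_smul] at hAA
    simpa [Ω₁] using congrFun (congrFun hAA 0) 1
  have hBC1 : C.det + B.det = 1 := by
    have h1 := mul_Ω₁_mul_transpose B
    rw [hBt] at h1
    rw [h1, transpose_mul_Ω₁_mul, ← add_smul] at hBB
    simpa [Ω₁] using congrFun (congrFun hBB 0) 1
  have hdet : B.det = A.det := by linarith
  obtain ⟨P, hP, hAP⟩ := exists_cholesky hA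
  obtain ⟨Q, hQ, hBQ⟩ := exists_cholesky hB
  rw [hdet] at hBQ
  have ha : 0 < Real.sqrt A.det := Real.sqrt_pos.mpr hA.det_pos
  have haa : Real.sqrt A.det * Real.sqrt A.det = A.det := Real.mul_self_sqrt hA.det_pos.le
  set a := Real.sqrt A.det
  have hPu : IsUnit P.det := by rw [hP]; exact isUnit_one
  have hQu : IsUnit Q.det := by rw [hQ]; exact isUnit_one
  have hQtu : IsUnit Qᵀ.det := by rwa [Matrix.det_transpose]
  obtain ⟨D, hD⟩ : ∃ D, C = P * D * Qᵀ := ⟨P⁻¹ * C * Qᵀ⁻¹, by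
    rw [Matrix.mul_assoc P, Matrix.mul_assoc (P⁻¹ * C), Matrix.nonsing_inv_mul _ hQtu,
      Matrix.mul_one, ← Matrix.mul_assoc, Matrix.mul_nonsing_inv _ hPu, Matrix.one_mul]⟩
  have hDdet : D.det = C.det := by
    rw [hD, Matrix.det_mul, Matrix.det_mul, Matrix.det_transpose, hP, hQ, one_mul, mul_one]
  -- The off-diagonal block of `V Ω₂ V = Ω₂`, expressed in the coordinates in which both diagonal
  -- blocks are the scalar `a`.
  have hanti : Ω₁ * D + D * Ω₁ = 0 := by
    have hPΩ : Pᵀ * Ω₁ * P = Ω₁ := by rw [transpose_mul_Ω₁_mul, hP, one_smul]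
    have hQΩ : Qᵀ * Ω₁ * Q = Ω₁ := by rw [transpose_mul_Ω₁_mul, hQ, one_smul]
    have h1 : A * Ω₁ * C = a • (P * (Ω₁ * D) * Qᵀ) := by
      calc A * Ω₁ * C = a • (P * ((Pᵀ * Ω₁ * P) * D) * Qᵀ) := by
            conv_lhs => rw [hAP, hD]
            simp only [Matrix.smul_mul, Matrix.mul_assoc]
        _ = _ := by rw [hPΩ]
    have h2 : C * Ω₁ * B = a • (P * (D * Ω₁) * Qᵀ) := by
      calc C * Ω₁ * B = a • (P * (D * (Qᵀ * Ω₁ * Q)) * Qᵀ) := by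
            conv_lhs => rw [hBQ, hD]
            simp only [Matrix.mul_smul, Matrix.mul_assoc]
        _ = _ := by rw [hQΩ]
    rw [h1, h2, ← smul_add, ← Matrix.add_mul, ← Matrix.mul_add] at hAC
    have h3 : P * (Ω₁ * D + D * Ω₁) * Qᵀ = 0 := (smul_eq_zero.mp hAC).resolve_left ha.ne'
    have h4 : P⁻¹ * (P * (Ω₁ * D + D * Ω₁) * Qᵀ) * Qᵀ⁻¹ = Ω₁ * D + D * Ω₁ := by
      rw [Matrix.mul_assoc P, ← Matrix.mul_assoc P⁻¹, Matrix.nonsing_inv_mul _ hPu,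
        Matrix.one_mul, Matrix.mul_assoc, Matrix.mul_nonsing_inv _ hQtu, Matrix.mul_one]
    rw [← h4, h3, Matrix.mul_zero, Matrix.zero_mul]
  have hDle : D.det ≤ 0 := by
    obtain ⟨e1, e2⟩ := entries_of_anticommute_Ω₁ hanti
    rw [Matrix.det_fin_two, e1, e2]
    nlinarith [sq_nonneg (D 0 0), sq_nonneg (D 0 1)]
  have ha1 : 1 ≤ a := by nlinarith
  -- The diagonal blocks of the squeezed covariance are `G + (G - 1)` times the identity, so `2G -
  -- 1` must equal `a`. Then `4G(G - 1) = a² - 1 = -det D`, which fixes the constant `c` below.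
  set G := (a + 1) / 2 with hG
  have hG1 : 1 ≤ G := by rw [hG]; linarith
  have hGa : 2 * G - 1 = a := by rw [hG]; ring
  have hs1 : Real.sqrt G * Real.sqrt G = G := Real.mul_self_sqrt (by linarith)
  have hs2 : Real.sqrt (G - 1) * Real.sqrt (G - 1) = G - 1 := Real.mul_self_sqrt (by linarith)
  obtain ⟨R, hR, hRR, hDR⟩ := exists_rotation hanti
    (c := 2 * (Real.sqrt G * Real.sqrt (G - 1))) (by
      have : 2 * (Real.sqrt G * Real.sqrt (G - 1)) * (2 * (Real.sqrt G * Real.sqrt (G - 1))) =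
        4 * ((Real.sqrt G * Real.sqrt G) * (Real.sqrt (G - 1) * Real.sqrt (G - 1))) := by ring
      rw [this, hs1, hs2, hDdet]
      have : A.det = (2 * G - 1) * (2 * G - 1) := by rw [hGa, haa]
      linarith)
  -- The rotation is absorbed into `Q`; being orthogonal, it leaves `Q Qᵀ` unchanged.
  refine ⟨P, Q * R, G, hP, by rw [Matrix.det_mul, hQ, hR, one_mul], hG1, ?_, ?_, ?_⟩
  · rw [hGa]; exact hAP
  · rw [hGa, Matrix.transpose_mul, Matrix.mul_assoc, ← Matrix.mul_assoc R, hRR, Matrix.one_mul]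
    exact hBQ
  · rw [hD, hDR, Matrix.transpose_mul, Matrix.mul_smul, Matrix.smul_mul]
    simp only [Matrix.mul_assoc]

theorem twoModeSqueezing_inv {G : ℝ} (hG : 1 ≤ G) :
    (twoModeSqueezing G)⁻¹ = Matrix.fromBlocks (Real.sqrt G • (1 : Matrix (Fin 2) (Fin 2) ℝ))
      (-(Real.sqrt (G - 1) • pauliZ)) (-(Real.sqrt (G - 1) • pauliZ))
      (Real.sqrt G • (1 : Matrix (Fin 2) (Fin 2) ℝ)) := by
  have h1 : Real.sqrt G * Real.sqrt G = G := Real.mul_self_sqrt (by linarith)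
  have h2 : Real.sqrt (G - 1) * Real.sqrt (G - 1) = G - 1 := Real.mul_self_sqrt (by linarith)
  apply Matrix.inv_eq_right_inv
  rw [twoModeSqueezing, Matrix.fromBlocks_multiply, ← Matrix.fromBlocks_one]
  congr 1 <;> simp [smul_smul, pauliZ_mul_pauliZ, h1, h2, mul_comm, ← sub_eq_add_neg, ← sub_smul,
    neg_add_eq_sub]

theorem exists_normalForm {S : Matrix (Fin 2 ⊕ Fin 2) (Fin 2 ⊕ Fin 2) ℝ}
    (hS : IsSymplectic Ω₂ S) :
    ∃ (P Q : Matrix (Fin 2) (Fin 2) ℝ) (G : ℝ), P.det = 1 ∧ Q.det = 1 ∧ 1 ≤ G ∧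
      S⁻¹ * S⁻¹ᵀ = (Matrix.fromBlocks P 0 0 Q * (twoModeSqueezing G)⁻¹) *
        (Matrix.fromBlocks P 0 0 Q * (twoModeSqueezing G)⁻¹)ᵀ := by
  have hV := covariance_symplectic hS
  have hpos : (S⁻¹ * S⁻¹ᵀ).PosDef := by
    have := Matrix.PosDef.mul_conjTranspose_self S⁻¹
      (Matrix.vecMul_injective_of_isUnit ((Matrix.isUnit_iff_isUnit_det _).mpr
        (Matrix.isUnit_nonsing_inv_det _ hS.isUnit_det)))
    simpa [Matrix.conjTranspose_eq_transpose_of_trivial] using this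
  have hC : (S⁻¹ * S⁻¹ᵀ).toBlocks₂₁ = (S⁻¹ * S⁻¹ᵀ).toBlocks₁₂ᵀ := by
    ext i j
    exact hpos.isHermitian.apply _ _
  generalize S⁻¹ * S⁻¹ᵀ = V at *
  have hA : V.toBlocks₁₁.PosDef := hpos.submatrix Sum.inl_injective
  have hB : V.toBlocks₂₂.PosDef := hpos.submatrix Sum.inr_injective
  have hVb := Matrix.fromBlocks_toBlocks V
  rw [hC] at hVb
  rw [← hVb] at hV
  obtain ⟨P, Q, G, hP, hQ, hG, hA', hB', hC'⟩ := exists_block_normalForm hA hB hV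
  refine ⟨P, Q, G, hP, hQ, hG, ?_⟩
  have h1 : Real.sqrt G * Real.sqrt G = G := Real.mul_self_sqrt (by linarith)
  have h2 : Real.sqrt (G - 1) * Real.sqrt (G - 1) = G - 1 := Real.mul_self_sqrt (by linarith)
  rw [← hVb, hC', hA', hB', twoModeSqueezing_inv hG, Matrix.fromBlocks_multiply,
    Matrix.fromBlocks_transpose, Matrix.fromBlocks_multiply]
  have hsum : Real.sqrt G * Real.sqrt G + Real.sqrt (G - 1) * Real.sqrt (G - 1) = 2 * G - 1 := by
    rw [h1, h2]
    ring
  have hZ : ∀ X : Matrix (Fin 2) (Fin 2) ℝ, pauliZ * (pauliZ * X) = X := fun X => by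
    rw [← Matrix.mul_assoc, pauliZ_mul_pauliZ, Matrix.one_mul]
  congr 1
  all_goals
    simp only [Matrix.zero_mul, Matrix.mul_neg, Matrix.mul_smul, Matrix.mul_one, add_zero, zero_add,
      Matrix.transpose_neg, Matrix.transpose_smul, Matrix.transpose_mul, Matrix.neg_mul,
      Matrix.transpose_transpose,
      Matrix.smul_mul, neg_neg, neg_zero, smul_zero, pauliZ_transpose, smul_smul, smul_neg,
      neg_smul, Matrix.mul_assoc, hZ]
  · rw [← hsum]; module
  · module
  · module
  · rw [← hsum]; module

/-! ### Syndromes -/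

theorem measurable_toIcoMod_ell : Measurable (toIcoMod ell_pos (-(ell / 2))) := by
  have h : toIcoMod ell_pos (-(ell / 2)) =
      fun b => -(ell / 2) + Int.fract ((b - -(ell / 2)) / ell) * ell :=
    funext fun b => toIcoMod_eq_add_fract_mul ell_pos _ b
  rw [h]
  fun_prop

theorem measurable_syndrome (M : Matrix (Fin 2) (Fin 2) ℝ) : Measurable (syndrome M) :=
  measurable_pi_lambda _ fun j => measurable_toIcoMod_ell.comp
    ((measurable_pi_apply j).comp (by fun_prop : Measurable fun e => (Mᵀ * Ω₁) *ᵥ e))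

/-- The syndrome of the sublattice with basis vectors `k j • v j`, from the syndrome of the lattice
with basis vectors `v j`. -/
def sublatticeSyndrome (k : Fin 2 → ℤ) (s : Fin 2 → ℝ) : Fin 2 → ℝ :=
  fun j => toIcoMod ell_pos (-(ell / 2)) (k j * s j)

theorem measurable_sublatticeSyndrome (k : Fin 2 → ℤ) : Measurable (sublatticeSyndrome k) :=
  measurable_pi_lambda _ fun j => measurable_toIcoMod_ell.comp
    (by fun_prop : Measurable fun s : Fin 2 → ℝ => (k j : ℝ) * s j)

/-- Since `k j` is an integer, multiplication by it is well defined modulo `ell`: the syndrome of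
the finer lattice determines that of the sublattice. -/
theorem syndrome_mul_diagonal (Λ : Matrix (Fin 2) (Fin 2) ℝ) (k : Fin 2 → ℤ) (e : Fin 2 → ℝ) :
    syndrome (Λ * Matrix.diagonal fun j => (k j : ℝ)) e = sublatticeSyndrome k (syndrome Λ e) := by
  ext j
  have h : (((Λ * Matrix.diagonal fun j => (k j : ℝ))ᵀ * Ω₁) *ᵥ e) j =
      k j * ((Λᵀ * Ω₁) *ᵥ e) j := by
    rw [Matrix.transpose_mul, Matrix.diagonal_transpose, Matrix.mul_assoc, ← Matrix.mulVec_mulVec,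
      Matrix.mulVec_diagonal]
  rw [syndrome, sublatticeSyndrome, syndrome, h]
  set x := ((Λᵀ * Ω₁) *ᵥ e) j
  have hx : (k j : ℝ) * x = k j * toIcoMod ell_pos (-(ell / 2)) x +
      (k j * toIcoDiv ell_pos (-(ell / 2)) x) • ell := by
    conv_lhs => rw [← toIcoMod_add_toIcoDiv_zsmul ell_pos (-(ell / 2)) x]
    simp only [zsmul_eq_mul]
    push_cast
    ring
  rw [hx, toIcoMod_add_zsmul]

theorem syndrome_mul_left {Q : Matrix (Fin 2) (Fin 2) ℝ} (hQ : Q.det = 1)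
    (Λ : Matrix (Fin 2) (Fin 2) ℝ) (e : Fin 2 → ℝ) :
    syndrome (Q * Λ) (Q *ᵥ e) = syndrome Λ e := by
  have h : (Q * Λ)ᵀ * Ω₁ * Q = Λᵀ * Ω₁ := by
    rw [Matrix.transpose_mul, Matrix.mul_assoc, Matrix.mul_assoc, ← Matrix.mul_assoc Qᵀ,
      transpose_mul_Ω₁_mul, hQ, one_smul]
  unfold syndrome
  rw [Matrix.mulVec_mulVec, h]

/-- A symplectically integral lattice is a sublattice of a symplectically self-dual one. -/
theorem IsIntegralLatticeBasis.exists_eq_mul_diagonal {M : Matrix (Fin 2) (Fin 2) ℝ}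
    (hM : IsIntegralLatticeBasis M) :
    ∃ (Λ : Matrix (Fin 2) (Fin 2) ℝ) (k : Fin 2 → ℤ), Λ.det = 1 ∧
      M = Λ * Matrix.diagonal fun j => (k j : ℝ) := by
  -- The only independent entry of `Mᵀ Ω₁ M` is `det M`, which is therefore a nonzero integer `n`.
  -- Dividing the first column by `n` gives determinant one.
  obtain ⟨n, hn⟩ := hM.integral 0 1
  rw [transpose_mul_Ω₁_mul] at hn
  have hdet : M.det = n := by simpa [Ω₁] using hn
  have hn0 : (n : ℝ) ≠ 0 := hdet ▸ hM.det_ne_zero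
  refine ⟨M * Matrix.diagonal ![(n : ℝ)⁻¹, 1], ![n, 1], ?_, ?_⟩
  · rw [Matrix.det_mul, Matrix.det_diagonal, hdet]
    simp [hn0]
  · rw [Matrix.mul_assoc, Matrix.diagonal_mul_diagonal]
    have h : (Matrix.diagonal fun i =>
        (![(n : ℝ)⁻¹, 1] i) * ((![n, 1] i : ℤ) : ℝ)) = (1 : Matrix (Fin 2) (Fin 2) ℝ) := by
      rw [← Matrix.diagonal_one]
      congr 1
      ext i
      fin_cases i <;> simp [hn0]
    rw [h, Matrix.mul_one]

/-! ### Second moments -/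

theorem memLp_two_of_integrable_sq {μ : Measure (Fin 2 → ℝ)}
    (h : ∀ i, Integrable (fun x : Fin 2 → ℝ => x i ^ 2) μ) (i : Fin 2) :
    MemLp (fun x : Fin 2 → ℝ => x i) 2 μ :=
  (memLp_two_iff_integrable_sq (measurable_pi_apply i).aestronglyMeasurable).mpr (h i)

theorem integrable_sq_map_mulVec {μ : Measure (Fin 2 → ℝ)} (P : Matrix (Fin 2) (Fin 2) ℝ)
    (h : ∀ i, Integrable (fun x : Fin 2 → ℝ => x i ^ 2) μ) (i : Fin 2) :
    Integrable (fun x : Fin 2 → ℝ => x i ^ 2) (μ.map fun x => P *ᵥ x) := by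
  rw [integrable_map_measure (by fun_prop : Measurable _).aestronglyMeasurable (by fun_prop)]
  have hm : MemLp (fun x : Fin 2 → ℝ => (P *ᵥ x) i) 2 μ := by
    simp only [Matrix.mulVec, dotProduct, Fin.sum_univ_two]
    exact ((memLp_two_of_integrable_sq h 0).const_mul _).add
      ((memLp_two_of_integrable_sq h 1).const_mul _)
  exact hm.integrable_sq

theorem secondMoments_map_mulVec {μ : Measure (Fin 2 → ℝ)} (P : Matrix (Fin 2) (Fin 2) ℝ)
    (h : ∀ i, Integrable (fun x : Fin 2 → ℝ => x i ^ 2) μ) :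
    (Matrix.of fun i j => ∫ x, x i * x j ∂(μ.map fun x => P *ᵥ x)) =
      P * (Matrix.of fun i j => ∫ x, x i * x j ∂μ) * Pᵀ := by
  have hint : ∀ i j, Integrable (fun x : Fin 2 → ℝ => x i * x j) μ := fun i j =>
    (memLp_two_of_integrable_sq h i).integrable_mul (memLp_two_of_integrable_sq h j)
  ext i j
  rw [Matrix.of_apply, integral_map (by fun_prop) (by fun_prop)]
  have hexp : ∀ x : Fin 2 → ℝ, (P *ᵥ x) i * (P *ᵥ x) j =
      ∑ a, ∑ b, P i a * P j b * (x a * x b) := by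
    intro x
    simp only [Matrix.mulVec, dotProduct, Fin.sum_univ_two]
    ring
  simp_rw [hexp]
  rw [integral_finsetSum _ fun a _ => integrable_finsetSum _ fun b _ => (hint a b).const_mul _]
  simp_rw [integral_finsetSum _ fun b _ => (hint _ b).const_mul _, integral_const_mul]
  simp only [Matrix.mul_apply, Matrix.of_apply, Matrix.transpose_apply, Fin.sum_univ_two]
  ring

namespace GKPO2OCode

theorem HasFiniteNoise.of_outputLaw_eq_map {C T : GKPO2OCode} {σ : ℝ}
    {P : Matrix (Fin 2) (Fin 2) ℝ} (hP : P.det = 1)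
    (h : C.outputLaw σ = (T.outputLaw σ).map (fun x => P *ᵥ x)) (hC : C.HasFiniteNoise σ) :
    T.HasFiniteNoise σ := by
  have hT : T.outputLaw σ = (C.outputLaw σ).map (fun x => P⁻¹ *ᵥ x) := by
    rw [h, Measure.map_map (by fun_prop) (by fun_prop)]
    have : (fun x => P⁻¹ *ᵥ x) ∘ (fun x => P *ᵥ x) = id := by
      ext1 x
      rw [Function.comp_apply, Matrix.mulVec_mulVec,
        Matrix.nonsing_inv_mul P (hP ▸ isUnit_one), Matrix.one_mulVec, id]
    rw [this, Measure.map_id]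
  intro i
  rw [hT]
  exact integrable_sq_map_mulVec _ hC i

/-- The second moments transform by congruence with `P`. Finite moments matter: a divergent integral
has the default value `0`, which need not respect the congruence. -/
theorem gmError_eq_of_outputLaw_eq_map {C T : GKPO2OCode} {σ : ℝ}
    {P : Matrix (Fin 2) (Fin 2) ℝ} (hP : P.det = 1)
    (h : C.outputLaw σ = (T.outputLaw σ).map (fun x => P *ᵥ x)) (hT : T.HasFiniteNoise σ) :
    T.gmError σ = C.gmError σ := by
  have hV : C.Vout σ = P * T.Vout σ * Pᵀ := by
    rw [Vout, h, secondMoments_map_mulVec P hT, Vout]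
  rw [gmError, gmError, hV, Matrix.det_mul, Matrix.det_mul, Matrix.det_transpose, hP, one_mul,
    mul_one]

/-! ### Reduction of a code to a two-mode-squeezing code -/

/-- The residual displacement as a function of the noise after decoding. -/
def decode (gen : Matrix (Fin 2) (Fin 2) ℝ) (est : (Fin 2 → ℝ) → (Fin 2 → ℝ))
    (x : Fin 2 ⊕ Fin 2 → ℝ) : Fin 2 → ℝ :=
  (fun i => x (Sum.inl i)) - est (syndrome gen fun i => x (Sum.inr i))

theorem measurable_decode (gen : Matrix (Fin 2) (Fin 2) ℝ) {est : (Fin 2 → ℝ) → (Fin 2 → ℝ)}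
    (h : Measurable est) : Measurable (decode gen est) :=
  Measurable.sub (by fun_prop) (h.comp ((measurable_syndrome gen).comp (by fun_prop)))

theorem residual_eq (C : GKPO2OCode) (ξ : Fin 2 ⊕ Fin 2 → ℝ) :
    C.residual ξ = decode C.gen C.est (C.enc⁻¹ *ᵥ ξ) := rfl

theorem measurable_residual (C : GKPO2OCode) : Measurable C.residual :=
  (measurable_decode C.gen C.est_measurable).comp
    (by fun_prop : Measurable fun ξ : Fin 2 ⊕ Fin 2 → ℝ => C.enc⁻¹ *ᵥ ξ)

/-- The new estimator first coarsens the syndrome of `Λ` to that of the sublattice, then applies `f`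
and compensates by `P⁻¹` for the `P` pulled out in front. -/
theorem decode_local_symplectic {P Q Λ : Matrix (Fin 2) (Fin 2) ℝ} (hP : P.det = 1)
    (hQ : Q.det = 1) (k : Fin 2 → ℤ) (f : (Fin 2 → ℝ) → (Fin 2 → ℝ)) (y : Fin 2 ⊕ Fin 2 → ℝ) :
    decode (Q * Λ * Matrix.diagonal fun j => (k j : ℝ)) f (Matrix.fromBlocks P 0 0 Q *ᵥ y) =
      P *ᵥ decode Λ (fun s => P⁻¹ *ᵥ f (sublatticeSyndrome k s)) y := by
  have hd : (fun i => (Matrix.fromBlocks P 0 0 Q *ᵥ y) (Sum.inl i)) =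
      P *ᵥ fun i => y (Sum.inl i) := by
    ext i
    simp [Matrix.fromBlocks_mulVec, Function.comp_def]
  have ha : (fun i => (Matrix.fromBlocks P 0 0 Q *ᵥ y) (Sum.inr i)) =
      Q *ᵥ fun i => y (Sum.inr i) := by
    ext i
    simp [Matrix.fromBlocks_mulVec, Function.comp_def]
  rw [decode, decode, hd, ha, syndrome_mul_diagonal, syndrome_mul_left hQ, Matrix.mulVec_sub,
    Matrix.mulVec_mulVec, Matrix.mul_nonsing_inv P (hP ▸ isUnit_one), Matrix.one_mulVec]

/-- Up to a symplectic transformation of the data mode, every GKP-O2O code has the output law of a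
two-mode-squeezing code. -/
theorem exists_isTMS_outputLaw_eq (C : GKPO2OCode) :
    ∃ (T : GKPO2OCode) (G : ℝ) (Λ P : Matrix (Fin 2) (Fin 2) ℝ), T.IsTMS G Λ ∧ P.det = 1 ∧
      ∀ σ : ℝ, C.outputLaw σ = (T.outputLaw σ).map (fun x => P *ᵥ x) := by
  obtain ⟨P, Q, G, hP, hQ, hG, hV⟩ := exists_normalForm C.enc_symplectic
  obtain ⟨Λ, k, hΛ, hgen⟩ := C.gen_integral.exists_eq_mul_diagonal
  have hQu : IsUnit Q.det := hQ ▸ isUnit_one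
  have hest : Measurable fun s => P⁻¹ *ᵥ C.est (sublatticeSyndrome k s) :=
    (by fun_prop : Measurable fun x : Fin 2 → ℝ => P⁻¹ *ᵥ x).comp
      (C.est_measurable.comp (measurable_sublatticeSyndrome k))
  have hΛ' : (Q⁻¹ * Λ).det = 1 := by
    rw [Matrix.det_mul, Matrix.det_nonsing_inv, hQ, hΛ]
    simp
  obtain ⟨T, hT, hTest⟩ := exists_isTMS hG hΛ' hest
  refine ⟨T, G, Q⁻¹ * Λ, P, hT, hP, fun σ => ?_⟩
  have hgen' : C.gen = Q * (Q⁻¹ * Λ) * Matrix.diagonal fun j => (k j : ℝ) := by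
    rw [← Matrix.mul_assoc Q, Matrix.mul_nonsing_inv Q hQu, Matrix.one_mul, hgen]
  have hC : C.outputLaw σ =
      ((iidAGN σ).map (fun ξ => C.enc⁻¹ *ᵥ ξ)).map (decode C.gen C.est) := by
    rw [Measure.map_map (measurable_decode _ C.est_measurable) (by fun_prop)]
    rfl
  -- Only here are noises exchanged that agree merely in law; the rest is an identity for each `ξ`.
  rw [hC, map_mulVec_iidAGN_eq σ hV,
    Measure.map_map (measurable_decode _ C.est_measurable) (by fun_prop), outputLaw,
    Measure.map_map (by fun_prop) T.measurable_residual]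
  congr 1
  ext1 ξ
  rw [Function.comp_apply, Function.comp_apply, residual_eq, hT.enc_eq, hT.gen_eq, hTest, hgen',
    ← Matrix.mulVec_mulVec, decode_local_symplectic hP hQ]

end GKPO2OCode

end GKP

end

theorem theorem4 :
    (∀ (G : ℝ) (Λ : Matrix (Fin 2) (Fin 2) ℝ) (f : (Fin 2 → ℝ) → (Fin 2 → ℝ)),
      1 ≤ G → GKP.IsSymplectic GKP.Ω₁ Λ → Measurable f →
        ∃ T : GKP.GKPO2OCode, T.IsTMS G Λ ∧ T.est = f) ∧
    (∀ C : GKP.GKPO2OCode,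
      ∃ (T : GKP.GKPO2OCode) (G : ℝ) (Λ P : Matrix (Fin 2) (Fin 2) ℝ),
        T.IsTMS G Λ ∧ GKP.IsSymplectic GKP.Ω₁ P ∧
        ∀ σ : ℝ, 0 < σ →
          C.outputLaw σ = (T.outputLaw σ).map (fun x => Matrix.mulVec P x) ∧
          (C.HasFiniteNoise σ → T.HasFiniteNoise σ ∧ T.gmError σ = C.gmError σ)) ∧
    (∀ σ : ℝ, 0 < σ →
      sInf {e : ℝ | ∃ C : GKP.GKPO2OCode, C.HasFiniteNoise σ ∧ e = C.gmError σ} =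
        sInf {e : ℝ | ∃ (T : GKP.GKPO2OCode) (G : ℝ) (Λ : Matrix (Fin 2) (Fin 2) ℝ),
          T.IsTMS G Λ ∧ T.HasFiniteNoise σ ∧ e = T.gmError σ} ∧
      ∀ (T : GKP.GKPO2OCode) (G : ℝ) (Λ : Matrix (Fin 2) (Fin 2) ℝ),
        T.IsTMS G Λ → T.HasFiniteNoise σ →
        (∀ (T' : GKP.GKPO2OCode) (G' : ℝ) (Λ' : Matrix (Fin 2) (Fin 2) ℝ),
          T'.IsTMS G' Λ' → T'.HasFiniteNoise σ → T.gmError σ ≤ T'.gmError σ) →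
        ∀ C : GKP.GKPO2OCode, C.HasFiniteNoise σ → T.gmError σ ≤ C.gmError σ) := by
  have key := fun C : GKP.GKPO2OCode => C.exists_isTMS_outputLaw_eq
  refine ⟨fun G Λ f hG hΛ hf => GKP.exists_isTMS hG ((GKP.isSymplectic_Ω₁_iff Λ).mp hΛ) hf,
    fun C => ?_, fun σ _ => ⟨?_, fun T G Λ _ _ hmin C hC => ?_⟩⟩
  · obtain ⟨T, G, Λ, P, hT, hP, hlaw⟩ := key C
    exact ⟨T, G, Λ, P, hT, (GKP.isSymplectic_Ω₁_iff P).mpr hP, fun σ _ => ⟨hlaw σ, fun hC =>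
      have hTn := GKP.GKPO2OCode.HasFiniteNoise.of_outputLaw_eq_map hP (hlaw σ) hC
      ⟨hTn, GKP.GKPO2OCode.gmError_eq_of_outputLaw_eq_map hP (hlaw σ) hTn⟩⟩⟩
  -- The two sets of attained errors coincide, so no boundedness or nonemptiness is needed to
  -- compare the infima.
  · congr 1
    ext e
    constructor
    · rintro ⟨C, hC, rfl⟩
      obtain ⟨T, G, Λ, P, hT, hP, hlaw⟩ := key C
      have hTn := GKP.GKPO2OCode.HasFiniteNoise.of_outputLaw_eq_map hP (hlaw σ) hC
      exact ⟨T, G, Λ, hT, hTn,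
        (GKP.GKPO2OCode.gmError_eq_of_outputLaw_eq_map hP (hlaw σ) hTn).symm⟩
    · rintro ⟨T, G, Λ, -, hTn, rfl⟩
      exact ⟨T, hTn, rfl⟩
  · obtain ⟨T', G', Λ', P, hT', hP, hlaw⟩ := key C
    have hTn := GKP.GKPO2OCode.HasFiniteNoise.of_outputLaw_eq_map hP (hlaw σ) hC
    rw [← GKP.GKPO2OCode.gmError_eq_of_outputLaw_eq_map hP (hlaw σ) hTn]
    exact hmin T' G' Λ' hT' hTn
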